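/- A pure state of two qubits is a unit vector $\psi\in\mathbb{C}^2\otimes\mathbb{C}^2$; its entropy of entanglement is $E(\psi)=-\operatorname{Tr}\rho_A\log\rho_A$ with $\rho_A=\operatorname{Tr}_B|\psi\rangle\langle\psi|$ ($\log$ is the natural logarithm, $0\log 0=0$). The state $\psi$ is called maximally entangled if $\rho_A=\tfrac12\mathbb{1}$, and separable if $\psi=a\otimes b$ for some $a,b\in\mathbb{C}^2$. For $W_2\in\mathcal{U}(4)$, acting on $\mathbb{C}^2\otimes\mathbb{C}^2$, consider the two splittings given by $W_1=\mathbb{1}$ and $W_2$ and the mutual entanglement $$\bar E(\psi)=\tfrac12\bigl(E(\psi)+E(W_2\psi)\bigr),$$ and let $E_{\max}$ and $E_{\min}$ denote its largest and its smallest value over all pure states $\psi$. Proposition ($N=2$, $L=2$). Let $W_2\in\mathcal{U}(4)$ be arbitrary. Then a) there is a pure state $\psi_{\mathrm{ent}}$ that is mutually entangled, i.e. both $\psi_{\mathrm{ent}}$ and $W_2\psi_{\mathrm{ent}}$ are maximally entangled, so that $\bar E(\psi_{\mathrm{ent}})=\log 2$; consequently $E_{\max}$ is attained and $E_{\max}=\log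 2$; b) there is a pure state $\psi_{\mathrm{sep}}$ that is mutually separable, i.e. both $\psi_{\mathrm{sep}}$ and $W_2\psi_{\mathrm{sep}}$ are separable, so that $\bar E(\psi_{\mathrm{sep}})=0$; consequently $E_{\min}$ is attained and $E_{\min}=0$. -/

import Mathlib

open scoped Matrix

/-- Pure-state vectors of the bipartite `N × N` system `ℂᴺ ⊗ ℂᴺ`, in coordinates with respect to the
computational product basis `|i, j⟩`. A (normalised) pure state is such a vector of norm `1`. -/
abbrev BipartiteVector (N : ℕ) : Type := EuclideanSpace ℂ (Fin N × Fin N)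

/-- Bipartite gates: the unitary matrices of order `N²`, indexed by the product basis. -/
abbrev BipartiteGate (N : ℕ) : Type := Matrix.unitaryGroup (Fin N × Fin N) ℂ

/-- The vector `W|ψ⟩`. -/
noncomputable def applyGate {N : ℕ} (W : BipartiteGate N) (ψ : BipartiteVector N) :
    BipartiteVector N :=
  WithLp.toLp 2 ((W : Matrix (Fin N × Fin N) (Fin N × Fin N) ℂ) *ᵥ ψ.ofLp)

/-- The operator `|ψ⟩⟨ψ|`. -/
def projector {N : ℕ} (ψ : BipartiteVector N) : Matrix (Fin N × Fin N) (Fin N × Fin N) ℂ :=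
  Matrix.vecMulVec ψ.ofLp (star ψ.ofLp)

/-- The partial trace over the second tensor factor. -/
def partialTraceB {N : ℕ} (ρ : Matrix (Fin N × Fin N) (Fin N × Fin N) ℂ) :
    Matrix (Fin N) (Fin N) ℂ :=
  Matrix.of fun i i' => ∑ j, ρ (i, j) (i', j)

/-- The reduced state `ρ_A = Tr_B |ψ⟩⟨ψ|`. -/
def reducedState {N : ℕ} (ψ : BipartiteVector N) : Matrix (Fin N) (Fin N) ℂ :=
  partialTraceB (projector ψ)

theorem reducedState_isHermitian {N : ℕ} (ψ : BipartiteVector N) :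
    (reducedState ψ).IsHermitian := by
  ext i j
  simp [reducedState, partialTraceB, projector, Matrix.vecMulVec_apply, mul_comm]

/-- The von Neumann entropy `-Tr ρ log ρ = -∑ λ log λ` of a Hermitian matrix `ρ`, the sum being over
its eigenvalues with multiplicity and `log` the natural logarithm, with `0 log 0 = 0`. -/
noncomputable def vonNeumannEntropy {N : ℕ} {ρ : Matrix (Fin N) (Fin N) ℂ}
    (hρ : ρ.IsHermitian) : ℝ :=
  ∑ i, Real.negMulLog (hρ.eigenvalues i)

/-- The entropy of entanglement `E(|ψ⟩) = S(Tr_B |ψ⟩⟨ψ|)`. -/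
noncomputable def entanglementEntropy {N : ℕ} (ψ : BipartiteVector N) : ℝ :=
  vonNeumannEntropy (reducedState_isHermitian ψ)

/-- The mutual entanglement `Ē = (1/L) ∑ⱼ E(Wⱼ|ψ⟩)`, averaged over the splittings given by the
gates `W₁, …, W_L`. -/
noncomputable def meanEntanglement {N L : ℕ} (W : Fin L → BipartiteGate N)
    (ψ : BipartiteVector N) : ℝ :=
  (1 / (L : ℝ)) * ∑ j, entanglementEntropy (applyGate (W j) ψ)

/-- The set of values that `Ē` takes on pure states; `E_min` and `E_max` are its least and its
greatest element. -/
def meanEntanglementValues {N L : ℕ} (W : Fin L → BipartiteGate N) : Set ℝ :=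
  {e | ∃ ψ : BipartiteVector N, ‖ψ‖ = 1 ∧ meanEntanglement W ψ = e}

/-- A pure state is maximally entangled when its reduced state is maximally mixed, `ρ_A = 𝟙 / N`. -/
def IsMaximallyEntangled {N : ℕ} (ψ : BipartiteVector N) : Prop :=
  reducedState ψ = (1 / (N : ℂ)) • (1 : Matrix (Fin N) (Fin N) ℂ)

/-- A pure state is separable when it is a product vector, `|ψ⟩ = |a⟩ ⊗ |b⟩`. -/
def IsProductVector {N : ℕ} (ψ : BipartiteVector N) : Prop :=
  ∃ a b : EuclideanSpace ℂ (Fin N), ∀ i j, ψ (i, j) = a i * b j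

/-- Maximally entangled with respect to every splitting given by the gates `W₁, …, W_L`. -/
def IsMutuallyEntangled {N L : ℕ} (W : Fin L → BipartiteGate N) (ψ : BipartiteVector N) : Prop :=
  ∀ j, IsMaximallyEntangled (applyGate (W j) ψ)

/-- Separable with respect to every splitting given by the gates `W₁, …, W_L`. -/
def IsMutuallySeparable {N L : ℕ} (W : Fin L → BipartiteGate N) (ψ : BipartiteVector N) : Prop :=
  ∀ j, IsProductVector (applyGate (W j) ψ)

/-! The reduced state of a two-qubit pure state has two nonnegative eigenvalues with sum 1, so its
entropy is a binary entropy and lies in `[0, log 2]`. It remains to attain both ends for the two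
splittings at once.

Separable end: every `|0⟩ ⊗ (x, y)` is a product, and its image under `W` is a product when a 2 × 2
determinant vanishes. That determinant is a binary quadratic form in `x, y`, so it has a nontrivial
complex zero (`exists_isMutuallySeparable`).

Entangled end: unit eigenvectors of the antiunitary spin flip `θ ψ = (σ_y ⊗ σ_y) ψ̄` are maximally
entangled. So a common eigenvector of the involutions `θ` and `θ' = W⁻¹ θ W` suffices; one is built
from an eigenvector of the unitary `θ' θ` (`exists_common_antiunitary_eigenvector`). -/

/-- The `N × N` matrix of coefficients of a bipartite vector. -/
def coeffMatrix {N : ℕ} (ψ : BipartiteVector N) : Matrix (Fin N) (Fin N) ℂ :=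
  Matrix.of fun i j => ψ (i, j)

theorem reducedState_eq_coeffMatrix_mul {N : ℕ} (ψ : BipartiteVector N) :
    reducedState ψ = coeffMatrix ψ * (coeffMatrix ψ)ᴴ := by
  ext i j
  simp [reducedState, partialTraceB, projector, coeffMatrix, Matrix.vecMulVec_apply,
    Matrix.mul_apply]

open scoped ComplexOrder in
theorem reducedState_posSemidef {N : ℕ} (ψ : BipartiteVector N) :
    (reducedState ψ).PosSemidef := by
  rw [reducedState_eq_coeffMatrix_mul]
  exact Matrix.posSemidef_self_mul_conjTranspose _

theorem star_dotProduct_self_eq {ι : Type*} [Fintype ι] (ψ : EuclideanSpace ℂ ι) :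
    star ψ.ofLp ⬝ᵥ ψ.ofLp = ((‖ψ‖ ^ 2 : ℝ) : ℂ) := by
  rw [EuclideanSpace.norm_sq_eq]
  simp [dotProduct, Complex.conj_mul']

theorem trace_reducedState {N : ℕ} (ψ : BipartiteVector N) :
    (reducedState ψ).trace = ((‖ψ‖ ^ 2 : ℝ) : ℂ) := by
  rw [← star_dotProduct_self_eq]
  simp [reducedState, partialTraceB, projector, Matrix.vecMulVec_apply, Matrix.trace,
    dotProduct, Fintype.sum_prod_type, mul_comm]

theorem norm_applyGate {N : ℕ} (W : BipartiteGate N) (ψ : BipartiteVector N) :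
    ‖applyGate W ψ‖ = ‖ψ‖ := by
  have h : star (applyGate W ψ).ofLp ⬝ᵥ (applyGate W ψ).ofLp = star ψ.ofLp ⬝ᵥ ψ.ofLp := by
    have hW : (W : Matrix (Fin N × Fin N) (Fin N × Fin N) ℂ)ᴴ * W.1 = 1 :=
      Matrix.mem_unitaryGroup_iff'.1 W.2
    simp only [applyGate]
    rw [Matrix.star_mulVec, Matrix.dotProduct_mulVec, Matrix.vecMul_vecMul, hW, Matrix.vecMul_one]
  rw [star_dotProduct_self_eq, star_dotProduct_self_eq] at h
  exact (sq_eq_sq₀ (norm_nonneg _) (norm_nonneg _)).1 (by exact_mod_cast h)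

theorem applyGate_one {N : ℕ} (ψ : BipartiteVector N) : applyGate 1 ψ = ψ := by
  simp [applyGate]

theorem applyGate_smul {N : ℕ} (W : BipartiteGate N) (c : ℂ) (ψ : BipartiteVector N) :
    applyGate W (c • ψ) = c • applyGate W ψ := by
  ext i
  simp [applyGate, Matrix.mulVec_smul]

theorem meanEntanglement_pair {N : ℕ} (W : BipartiteGate N) (ψ : BipartiteVector N) :
    meanEntanglement ![1, W] ψ =
      (entanglementEntropy ψ + entanglementEntropy (applyGate W ψ)) / 2 := by
  simp [meanEntanglement, Fin.sum_univ_two, applyGate_one]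
  ring

/-! ### Entropy of two-qubit states -/

theorem eigenvalues_sum_eq_one {ψ : BipartiteVector 2} (hψ : ‖ψ‖ = 1) :
    (reducedState_isHermitian ψ).eigenvalues 0 + (reducedState_isHermitian ψ).eigenvalues 1 = 1 := by
  have h := (reducedState_isHermitian ψ).trace_eq_sum_eigenvalues
  rw [trace_reducedState, hψ, Fin.sum_univ_two] at h
  exact_mod_cast (by simpa using h.symm :
    ((reducedState_isHermitian ψ).eigenvalues 0 : ℂ) + (reducedState_isHermitian ψ).eigenvalues 1 = 1)

theorem entanglementEntropy_eq_binEntropy {ψ : BipartiteVector 2} (hψ : ‖ψ‖ = 1) :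
    entanglementEntropy ψ = Real.binEntropy ((reducedState_isHermitian ψ).eigenvalues 0) := by
  have h := eigenvalues_sum_eq_one hψ
  rw [entanglementEntropy, vonNeumannEntropy, Fin.sum_univ_two,
    Real.binEntropy_eq_negMulLog_add_negMulLog_one_sub, ← h, add_sub_cancel_left]

theorem entanglementEntropy_le_log_two {ψ : BipartiteVector 2} (hψ : ‖ψ‖ = 1) :
    entanglementEntropy ψ ≤ Real.log 2 := by
  rw [entanglementEntropy_eq_binEntropy hψ]
  exact Real.binEntropy_le_log_two

open scoped ComplexOrder in
theorem entanglementEntropy_nonneg {ψ : BipartiteVector 2} (hψ : ‖ψ‖ = 1) :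
    0 ≤ entanglementEntropy ψ := by
  rw [entanglementEntropy_eq_binEntropy hψ]
  have h := eigenvalues_sum_eq_one hψ
  have h0 := (reducedState_posSemidef ψ).eigenvalues_nonneg 0
  have h1 := (reducedState_posSemidef ψ).eigenvalues_nonneg 1
  exact Real.binEntropy_nonneg h0 (by linarith)

theorem eigenvalues_prod_eq {ψ : BipartiteVector 2} {d : ℝ}
    (h : (reducedState ψ).det = (d : ℂ)) :
    (reducedState_isHermitian ψ).eigenvalues 0 * (reducedState_isHermitian ψ).eigenvalues 1 = d := by
  rw [(reducedState_isHermitian ψ).det_eq_prod_eigenvalues, Fin.prod_univ_two] at h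
  exact Complex.ofReal_injective (by simpa using h)

theorem IsMaximallyEntangled.entanglementEntropy_eq {ψ : BipartiteVector 2} (hψ : ‖ψ‖ = 1)
    (h : IsMaximallyEntangled ψ) : entanglementEntropy ψ = Real.log 2 := by
  have hs := eigenvalues_sum_eq_one hψ
  have hp := eigenvalues_prod_eq (ψ := ψ) (d := 1 / 4) (by
    rw [show reducedState ψ = _ from h, Matrix.det_smul]
    norm_num)
  rw [entanglementEntropy_eq_binEntropy hψ, ← Real.binEntropy_two_inv]
  congr 1
  -- Sum 1 and product 1/4 make 1/2 a double root: `(λ₀ - 1/2)² = 0`.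
  rw [← sub_eq_zero]
  refine pow_eq_zero_iff two_ne_zero |>.1 ?_
  linear_combination (reducedState_isHermitian ψ).eigenvalues 0 * hs - hp

theorem IsProductVector.entanglementEntropy_eq {ψ : BipartiteVector 2} (hψ : ‖ψ‖ = 1)
    (h : IsProductVector ψ) : entanglementEntropy ψ = 0 := by
  obtain ⟨a, b, hab⟩ := h
  have hs := eigenvalues_sum_eq_one hψ
  have hp := eigenvalues_prod_eq (ψ := ψ) (d := 0) (by
    have : (coeffMatrix ψ).det = 0 := by
      simp only [coeffMatrix, Matrix.det_fin_two, Matrix.of_apply, hab]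
      ring
    rw [reducedState_eq_coeffMatrix_mul, Matrix.det_mul, this]
    simp)
  rw [entanglementEntropy_eq_binEntropy hψ]
  rcases mul_eq_zero.1 hp with h0 | h1
  · rw [h0, Real.binEntropy_zero]
  · rw [h1, add_zero] at hs
    rw [hs, Real.binEntropy_one]

/-! ### Mutually separable states -/

theorem isProductVector_of_det_eq_zero {ψ : BipartiteVector 2}
    (h : ψ (0, 0) * ψ (1, 1) = ψ (0, 1) * ψ (1, 0)) : IsProductVector ψ := by
  by_cases h0 : ψ (0, 0) = 0
  · by_cases h1 : ψ (0, 1) = 0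
    · refine ⟨!₂[0, 1], !₂[ψ (1, 0), ψ (1, 1)], fun i j => ?_⟩
      fin_cases i <;> fin_cases j <;> simp [h0, h1]
    · refine ⟨!₂[1, ψ (1, 1) / ψ (0, 1)], !₂[ψ (0, 0), ψ (0, 1)], fun i j => ?_⟩
      have h2 : ψ (1, 0) = 0 := by simpa [h0, h1] using h
      fin_cases i <;> fin_cases j <;> simp [h0, h1, h2]
  · refine ⟨!₂[1, ψ (1, 0) / ψ (0, 0)], !₂[ψ (0, 0), ψ (0, 1)], fun i j => ?_⟩
    fin_cases i <;> fin_cases j <;> simp [h0]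
    field_simp
    linear_combination h

theorem exists_binary_quadratic_zero {K : Type*} [Field K] [IsAlgClosed K] [NeZero (2 : K)]
    (a b c : K) : ∃ x y : K, (x ≠ 0 ∨ y ≠ 0) ∧ a * x ^ 2 + b * x * y + c * y ^ 2 = 0 := by
  by_cases ha : a = 0
  · exact ⟨1, 0, Or.inl one_ne_zero, by simp [ha]⟩
  · obtain ⟨s, hs⟩ := IsAlgClosed.exists_pow_nat_eq (discrim a b c) (n := 2) two_pos
    obtain ⟨x, hx⟩ := exists_quadratic_eq_zero ha ⟨s, by rw [← hs, sq]⟩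
    exact ⟨x, 1, Or.inr one_ne_zero, by linear_combination hx⟩

theorem exists_isMutuallySeparable (W : BipartiteGate 2) :
    ∃ ψ : BipartiteVector 2, ‖ψ‖ = 1 ∧ IsProductVector ψ ∧ IsProductVector (applyGate W ψ) := by
  let M := (W : Matrix (Fin 2 × Fin 2) (Fin 2 × Fin 2) ℂ)
  let p := fun k => M k (0, 0)
  let q := fun k => M k (0, 1)
  -- These are the coefficients of the determinant of `x p + y q`, the image of `|0⟩ ⊗ (x, y)`, read
  -- as a 2 × 2 matrix.
  obtain ⟨x, y, hxy, h⟩ := exists_binary_quadratic_zero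
    (p (0, 0) * p (1, 1) - p (0, 1) * p (1, 0))
    (p (0, 0) * q (1, 1) + q (0, 0) * p (1, 1) - p (0, 1) * q (1, 0) - q (0, 1) * p (1, 0))
    (q (0, 0) * q (1, 1) - q (0, 1) * q (1, 0))
  let φ : BipartiteVector 2 := WithLp.toLp 2 fun k => !![x, y; 0, 0] k.1 k.2
  have hφ : φ ≠ 0 := by
    intro h0
    have hx : φ (0, 0) = 0 := by rw [h0]; rfl
    have hy : φ (0, 1) = 0 := by rw [h0]; rfl
    rcases hxy with hx' | hy'
    · exact hx' hx
    · exact hy' hy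
  have hW : ∀ k, applyGate W φ k = p k * x + q k * y := fun k => by
    simp [applyGate, φ, Matrix.mulVec, dotProduct, Fintype.sum_prod_type, p, q, M]
  refine ⟨(‖φ‖⁻¹ : ℂ) • φ, ?_, isProductVector_of_det_eq_zero ?_,
    isProductVector_of_det_eq_zero ?_⟩
  · simp [norm_smul, hφ]
  · simp [φ]
  · simp only [applyGate_smul, PiLp.smul_apply, smul_eq_mul, hW]
    linear_combination (‖φ‖⁻¹ : ℂ) ^ 2 * h

/-! ### Spin flip and mutually entangled states -/

/-- The real symmetric involution `σ_y ⊗ σ_y`. -/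
def spinFlipMatrix : Matrix (Fin 2 × Fin 2) (Fin 2 × Fin 2) ℂ :=
  Matrix.of fun k l => if l = (k.1 + 1, k.2 + 1) then (if k.1 = k.2 then -1 else 1) else 0

theorem spinFlipMatrix_conjTranspose : spinFlipMatrixᴴ = spinFlipMatrix := by
  ext ⟨i, j⟩ ⟨k, l⟩
  fin_cases i <;> fin_cases j <;> fin_cases k <;> fin_cases l <;> simp [spinFlipMatrix]

theorem spinFlipMatrix_mul_self : spinFlipMatrix * spinFlipMatrix = 1 := by
  ext ⟨i, j⟩ ⟨k, l⟩
  fin_cases i <;> fin_cases j <;> fin_cases k <;> fin_cases l <;>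
    simp [spinFlipMatrix, Matrix.mul_apply, Fintype.sum_prod_type]

theorem spinFlipMatrix_map_star : spinFlipMatrix.map star = spinFlipMatrix := by
  ext ⟨i, j⟩ ⟨k, l⟩
  fin_cases i <;> fin_cases j <;> fin_cases k <;> fin_cases l <;> simp [spinFlipMatrix]

theorem star_mulVec_eq_map_star_mulVec {ι κ : Type*} [Fintype κ] (A : Matrix ι κ ℂ) (v : κ → ℂ) :
    star (A *ᵥ v) = A.map star *ᵥ star v := by
  ext i
  simp [Matrix.mulVec, dotProduct]

/-- If `(a, b)` and `(c, d)` are the rows of the coefficient matrix, the eigenvector equation says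
`(c̄, d̄) = μ (b, -a)` and `(ā, b̄) = μ (-d, c)`. Hence the rows are orthogonal with equal norms,
and trace 1 makes each squared norm 1/2. -/
theorem isMaximallyEntangled_of_spinFlip {ψ : BipartiteVector 2} (hψ : ‖ψ‖ = 1) {μ : ℂ}
    (h : spinFlipMatrix *ᵥ star ψ.ofLp = μ • ψ.ofLp) : IsMaximallyEntangled ψ := by
  have h00 := congrFun h (0, 0)
  have h01 := congrFun h (0, 1)
  have h10 := congrFun h (1, 0)
  have h11 := congrFun h (1, 1)
  simp [spinFlipMatrix, Matrix.mulVec, dotProduct] at h00 h01 h10 h11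
  have hn := trace_reducedState ψ
  rw [hψ, reducedState_eq_coeffMatrix_mul] at hn
  simp [Matrix.trace, Matrix.mul_apply, Fin.sum_univ_two, coeffMatrix] at hn
  rw [IsMaximallyEntangled, reducedState_eq_coeffMatrix_mul]
  ext i j
  fin_cases i <;> fin_cases j <;>
    simp [Matrix.mul_apply, Fin.sum_univ_two, coeffMatrix]
  · linear_combination hn / 2 + (ψ (1, 1) * h00 - ψ (1, 0) * h01 + ψ (0, 1) * h10 - ψ (0, 0) * h11) / 2
  · linear_combination ψ (0, 0) * h01 - ψ (0, 1) * h00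
  · linear_combination ψ (1, 1) * h10 - ψ (1, 0) * h11
  · linear_combination hn / 2 - (ψ (1, 1) * h00 - ψ (1, 0) * h01 + ψ (0, 1) * h10 - ψ (0, 0) * h11) / 2

open scoped ComplexOrder in
theorem star_mul_self_of_unitary_mulVec {ι : Type*} [Fintype ι] [DecidableEq ι]
    {T : Matrix ι ι ℂ} (hT : Tᴴ * T = 1) {v : ι → ℂ} (hv : v ≠ 0) {c : ℂ} (h : T *ᵥ v = c • v) :
    star c * c = 1 := by
  have h1 : star (T *ᵥ v) ⬝ᵥ (T *ᵥ v) = star v ⬝ᵥ v := by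
    rw [Matrix.star_mulVec, Matrix.dotProduct_mulVec, Matrix.vecMul_vecMul, hT, Matrix.vecMul_one]
  rw [h, star_smul, smul_dotProduct, dotProduct_smul, smul_smul, smul_eq_mul] at h1
  have h2 : star v ⬝ᵥ v ≠ 0 := by
    rwa [Ne, dotProduct_star_self_eq_zero]
  exact mul_right_cancel₀ h2 (by rw [h1, one_mul])

theorem exists_mulVec_eq_smul {ι : Type*} [Fintype ι] [DecidableEq ι] [Nonempty ι]
    (T : Matrix ι ι ℂ) : ∃ v : ι → ℂ, v ≠ 0 ∧ ∃ c : ℂ, T *ᵥ v = c • v := by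
  obtain ⟨c, hc⟩ := Module.End.exists_eigenvalue (Matrix.toLin' T)
  obtain ⟨v, hv⟩ := hc.exists_hasEigenvector
  exact ⟨v, hv.2, c, by simpa using hv.apply_eq_smul⟩

/-- Antiunitary involutions `v ↦ J v̄` and `v ↦ J' v̄` have a common eigenvector, fixed by the
first. -/
theorem exists_common_antiunitary_eigenvector {ι : Type*} [Fintype ι] [DecidableEq ι] [Nonempty ι]
    {J J' : Matrix ι ι ℂ} (hJ : J * J.map star = 1) (hJ' : J' * J'.map star = 1)
    (hU : Jᴴ * J = 1) (hU' : J'ᴴ * J' = 1) :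
    ∃ v : ι → ℂ, v ≠ 0 ∧ J *ᵥ star v = v ∧ ∃ c : ℂ, J' *ᵥ star v = c • v := by
  obtain ⟨v, hv, c, hc⟩ := exists_mulVec_eq_smul (J' * J.map star)
  have hJr : J.map star * J = 1 := mul_eq_one_comm.1 hJ
  have hc1 : star c * c = 1 := by
    refine star_mul_self_of_unitary_mulVec ?_ hv hc
    have hs : (J.map star)ᴴ * J.map star = 1 := by
      have := congrArg (fun A : Matrix ι ι ℂ => A.map star) hU
      ext i j
      have h := congrFun (congrFun this i) j
      simpa [Matrix.mul_apply, Matrix.one_apply, apply_ite] using h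
    rw [Matrix.conjTranspose_mul, Matrix.mul_assoc, ← Matrix.mul_assoc _ J', hU', Matrix.one_mul, hs]
  -- The flipped vector `w` is an eigenvector with the same eigenvalue.
  set w := J *ᵥ star v with hw
  have hww : J *ᵥ star w = v := by
    rw [hw, star_mulVec_eq_map_star_mulVec, star_star, Matrix.mulVec_mulVec, hJ, Matrix.one_mulVec]
  have hvw : J' *ᵥ star w = c • v := by
    rw [hw, star_mulVec_eq_map_star_mulVec, star_star, Matrix.mulVec_mulVec, hc]
  -- Applying the second involution to `hvw` gives `w = c̄ J' v̄`, by antilinearity; then `|c| = 1`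
  -- inverts the scalar.
  have hwv : J' *ᵥ star v = c • w := by
    have h1 : w = star c • J' *ᵥ star v := by
      have h2 := congrArg (fun u => J' *ᵥ star u) hvw
      simp only [star_mulVec_eq_map_star_mulVec, star_star, Matrix.mulVec_mulVec, hJ',
        Matrix.one_mulVec, star_smul, Matrix.mulVec_smul] at h2
      exact h2
    rw [h1, smul_smul, mul_comm c, hc1, one_smul]
  -- Both involutions exchange the lines of `v` and `w`, so `v + w` works unless it vanishes; then
  -- `w = -v`, and the factor `i` absorbs the sign.
  by_cases hs : v + w = 0
  · refine ⟨Complex.I • v, by simpa using hv, ?_, -c * -1, ?_⟩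
    · have : w = -v := by rw [eq_neg_iff_add_eq_zero, add_comm, hs]
      rw [star_smul, Matrix.mulVec_smul, ← hw, this]
      simp
    · have : w = -v := by rw [eq_neg_iff_add_eq_zero, add_comm, hs]
      rw [star_smul, Matrix.mulVec_smul, hwv, this]
      simp [smul_comm c Complex.I v]
  · refine ⟨v + w, hs, ?_, c, ?_⟩
    · rw [star_add, Matrix.mulVec_add, ← hw, hww, add_comm]
    · rw [star_add, Matrix.mulVec_add, hwv, hvw, smul_add, add_comm]

theorem exists_isMutuallyEntangled (W : BipartiteGate 2) :
    ∃ ψ : BipartiteVector 2, ‖ψ‖ = 1 ∧ IsMaximallyEntangled ψ ∧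
      IsMaximallyEntangled (applyGate W ψ) := by
  set M := (W : Matrix (Fin 2 × Fin 2) (Fin 2 × Fin 2) ℂ) with hM
  have hW : Mᴴ * M = 1 := Matrix.mem_unitaryGroup_iff'.1 W.2
  have hW' : M * Mᴴ = 1 := mul_eq_one_comm.1 hW
  have hWs : M.map star * Mᵀ = 1 := by
    have := congrArg Matrix.transpose hW'
    rwa [Matrix.transpose_mul, Matrix.transpose_one] at this
  have hJJ := spinFlipMatrix_mul_self
  have hMs : Mᴴ.map star = Mᵀ := by
    ext i j
    simp
  have hMs' : (M.map star)ᴴ = Mᵀ := by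
    ext i j
    simp
  -- The map `v ↦ J' v̄` is the spin flip conjugated by `W`.
  set J' := Mᴴ * spinFlipMatrix * M.map star with hJ'
  have hs : J'.map star = Mᵀ * spinFlipMatrix * M := by
    have h (A B : Matrix (Fin 2 × Fin 2) (Fin 2 × Fin 2) ℂ) :
        (A * B).map star = A.map star * B.map star := Matrix.map_mul (f := starRingEnd ℂ)
    rw [hJ', h, h, hMs, spinFlipMatrix_map_star]
    congr 1
    ext i j
    simp
  have hc : J'ᴴ = Mᵀ * spinFlipMatrix * M := by
    rw [hJ', Matrix.conjTranspose_mul, Matrix.conjTranspose_mul, hMs',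
      spinFlipMatrix_conjTranspose, Matrix.conjTranspose_conjTranspose, Matrix.mul_assoc]
  have h1 : J' * J'.map star = 1 := by
    calc J' * J'.map star = Mᴴ * spinFlipMatrix * (M.map star * Mᵀ) * spinFlipMatrix * M := by
          rw [hs, hJ']
          simp only [Matrix.mul_assoc]
      _ = Mᴴ * (spinFlipMatrix * spinFlipMatrix) * M := by
          rw [hWs]
          simp only [Matrix.mul_assoc, Matrix.one_mul]
      _ = 1 := by rw [hJJ, Matrix.mul_one, hW]
  obtain ⟨v, hv, h1, c, h2⟩ := exists_common_antiunitary_eigenvector (J := spinFlipMatrix)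
    (by rw [spinFlipMatrix_map_star, hJJ]) h1 (by rw [spinFlipMatrix_conjTranspose, hJJ])
    (by rw [hc, ← hs, mul_eq_one_comm, h1])
  let φ : BipartiteVector 2 := WithLp.toLp 2 v
  have hφ : φ ≠ 0 := fun h => hv (by simpa [φ] using h)
  have hn : ‖(‖φ‖⁻¹ : ℂ) • φ‖ = 1 := by simp [norm_smul, hφ]
  refine ⟨(‖φ‖⁻¹ : ℂ) • φ, hn, isMaximallyEntangled_of_spinFlip (μ := 1) hn ?_,
    isMaximallyEntangled_of_spinFlip (μ := c) ((norm_applyGate _ _).trans hn) ?_⟩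
  · simp [φ, Matrix.mulVec_smul, h1]
  · have h3 : spinFlipMatrix *ᵥ (M.map star *ᵥ star v) = c • M *ᵥ v := by
      have h := congrArg (fun u => M *ᵥ u) h2
      simp only [hJ', Matrix.mulVec_mulVec, Matrix.mulVec_smul] at h
      rw [← h, Matrix.mulVec_mulVec, ← Matrix.mul_assoc, ← Matrix.mul_assoc, hW', Matrix.one_mul]
    rw [applyGate_smul]
    simp only [applyGate, φ, ← hM, WithLp.ofLp_smul, star_smul, star_mulVec_eq_map_star_mulVec,
      Matrix.mulVec_smul, h3]
    simp [smul_comm c]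

theorem mainTheorem3 (W₂ : BipartiteGate 2) :
    ((∃ ψ : BipartiteVector 2, ‖ψ‖ = 1 ∧ IsMutuallyEntangled ![1, W₂] ψ ∧
        meanEntanglement ![1, W₂] ψ = Real.log 2) ∧
      IsGreatest (meanEntanglementValues ![1, W₂]) (Real.log 2)) ∧
    ((∃ ψ : BipartiteVector 2, ‖ψ‖ = 1 ∧ IsMutuallySeparable ![1, W₂] ψ ∧
        meanEntanglement ![1, W₂] ψ = 0) ∧
      IsLeast (meanEntanglementValues ![1, W₂]) 0) := by
  obtain ⟨ψ, hψ, h1, h2⟩ := exists_isMutuallyEntangled W₂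
  obtain ⟨φ, hφ, g1, g2⟩ := exists_isMutuallySeparable W₂
  have hψ' : meanEntanglement ![1, W₂] ψ = Real.log 2 := by
    rw [meanEntanglement_pair, h1.entanglementEntropy_eq hψ,
      h2.entanglementEntropy_eq ((norm_applyGate _ _).trans hψ), add_self_div_two]
  have hφ' : meanEntanglement ![1, W₂] φ = 0 := by
    rw [meanEntanglement_pair, g1.entanglementEntropy_eq hφ,
      g2.entanglementEntropy_eq ((norm_applyGate _ _).trans hφ), add_self_div_two]
  refine ⟨⟨⟨ψ, hψ, ?_, hψ'⟩, ⟨ψ, hψ, hψ'⟩, ?_⟩, ⟨φ, hφ, ?_, hφ'⟩, ⟨φ, hφ, hφ'⟩, ?_⟩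
  · simpa [IsMutuallyEntangled, Fin.forall_fin_two, applyGate_one] using ⟨h1, h2⟩
  · rintro _ ⟨χ, hχ, rfl⟩
    rw [meanEntanglement_pair]
    linarith [entanglementEntropy_le_log_two hχ,
      entanglementEntropy_le_log_two ((norm_applyGate W₂ χ).trans hχ)]
  · simpa [IsMutuallySeparable, Fin.forall_fin_two, applyGate_one] using ⟨g1, g2⟩
  · rintro _ ⟨χ, hχ, rfl⟩
    rw [meanEntanglement_pair]
    linarith [entanglementEntropy_nonneg hχ,
      entanglementEntropy_nonneg ((norm_applyGate W₂ χ).trans hχ)]
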